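/- Let $q$ be a complex number with $0<|q|<1$, and put $(x;q)_n=\prod_{j=0}^{n-1}(1-q^jx)$ and $(x;q)_\infty=\prod_{j\ge 0}(1-q^jx)$. Let $L_n(x,s)$ be the Lucas polynomials, given by $L_0(x,s)=2$, $L_1(x,s)=x$ and $L_n(x,s)=xL_{n-1}(x,s)+sL_{n-2}(x,s)$ for $n\ge 2$. Let $D$ be the $q$-differentiation operator on polynomials in $x$, $Df(x)=\frac{f(x)-f(qx)}{(1-q)x}$, and define the $q$-Lucas polynomials by $L_n(x,s,q)=L_n(x+(q-1)sD,\,s)\,1$, i.e. the operator $x+(q-1)sD$ (where $x$ acts by multiplication) is substituted for $x$ in $L_n(x,s)$ and the resulting operator is applied to the constant polynomial $1$. Let $L_n^*(x,s,q)=L_n(x,s,q)$ for $n>0$ and $L_0^*(x,s,q)=1$. Then $(q;q)_\infty$ converges to a nonzero number, the three series below converge absolutely, and $$\sum_{n\ge 0}\frac{q^{n^2+n}}{(q;q)_{2n}}=\frac{1}{(q;q)_\infty}\sum_{k\ge 0}L_{2k}^*(1,-q^{-1},q)\,q^{k^2+k}=\frac{1}{(q;q)_\infty}\sum_{k\in\mathbb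 Z}\left(q^{15k^2+2k}-q^{15k^2+8k+1}\right).$$ -/

import Mathlib

noncomputable section

open Polynomial

namespace QLucas

/-- The finite `q`-shifted factorial `(x; q)_n = ∏_{j=0}^{n-1} (1 - q^j x)`. -/
def qPoch (x q : ℂ) (n : ℕ) : ℂ :=
  ∏ j ∈ Finset.range n, (1 - q ^ j * x)

/-- The infinite `q`-shifted factorial `(x; q)_∞ = ∏_{j ≥ 0} (1 - q^j x)`. -/
def qPochInf (x q : ℂ) : ℂ :=
  ∏' j : ℕ, (1 - q ^ j * x)

/-- The classical Lucas polynomials `L_n(x, s)`, as polynomials in `x`: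
`L_0 = 2`, `L_1 = x`, `L_n = x L_{n-1} + s L_{n-2}`. -/
def lucas (s : ℂ) : ℕ → ℂ[X]
  | 0 => 2
  | 1 => X
  | n + 2 => X * lucas s (n + 1) + C s * lucas s n

/-- The `q`-differentiation operator `(D f)(x) = (f(x) - f(qx)) / ((1 - q) x)` on polynomials.
The polynomial `f(x) - f(qx)` has constant term zero, so `divX` is exact division by `x`. -/
def qDeriv (q : ℂ) : Module.End ℂ ℂ[X] where
  toFun f := (1 - q)⁻¹ • (f - f.comp (C q * X)).divX
  map_add' f g := by
    rw [← smul_add, ← divX_add, add_comp]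
    congr 2
    ring
  map_smul' c f := by
    rw [RingHom.id_apply, smul_comp, ← smul_sub, smul_eq_C_mul c, divX_C_mul, ← smul_eq_C_mul,
      smul_comm]

/-- The operator `x + (q - 1) s D` on polynomials in `x`. -/
def lucasOp (s q : ℂ) : Module.End ℂ ℂ[X] :=
  LinearMap.mulLeft ℂ X + ((q - 1) * s) • qDeriv q

/-- The `q`-Lucas polynomials as polynomials in `x`: `L_n(x, s, q) = L_n(x + (q - 1) s D, s) 1`. -/
def qLucas (s q : ℂ) (n : ℕ) : ℂ[X] :=
  aeval (lucasOp s q) (lucas s n) 1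

/-- The values `L*_n(x, s, q)`, equal to `L_n(x, s, q)` for `n > 0` and to `1` for `n = 0`. -/
def qLucasStar (x s q : ℂ) (n : ℕ) : ℂ :=
  if n = 0 then 1 else (qLucas s q n).eval x

end QLucas

end

noncomputable section

open Polynomial

namespace QLucas

/-! ### Gaussian binomial sums as functionals on sequences -/

section Functional

variable {M M' : Type*} [AddCommGroup M] [Module ℂ M] [AddCommGroup M'] [Module ℂ M']

/-! This is a Bailey pair argument. Let `d = thetaDiff q`. Pascal-rule manipulation gives `∑ d m /
((q;q)_(n-m) (q;q)_(n+m)) = q^n / (q;q)_(2n)` (`qBinomSum_thetaDiff`). Multiplying by `q^(n^2)`,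
summing over `n` and interchanging, Cauchy's identity turns the inner sum into `q^(m^2) / (q;q)_∞`,
so the first series is `(q;q)_∞⁻¹ ∑ d m q^(m^2)`.

The support of `d` makes this sum the theta series. For the Lucas series, expanding `X^(2n)` in
`q`-Lucas polynomials at `x = 1` shows that `q^m L_(2m)` and `d m + d (-m)` have the same central
Gaussian binomial sums `2 q^n`; these sums are triangular, so the sequences agree. -/

/-- The functional `f ↦ ∑ k, [n, k] f k`, where `[n, k]` is the Gaussian binomial coefficient,
defined through the `q`-Pascal rule. -/
def qBinomSum (q : ℂ) : ℕ → (ℤ → M) → M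
  | 0, f => f 0
  | n + 1, f => qBinomSum q n fun k => f (k + 1) + q ^ k • f k

theorem qBinomSum_add (q : ℂ) (n : ℕ) (f g : ℤ → M) :
    qBinomSum q n (fun k => f k + g k) = qBinomSum q n f + qBinomSum q n g := by
  induction n generalizing f g with
  | zero => rfl
  | succ n ih =>
    simp only [qBinomSum]
    rw [← ih]
    congr 1
    funext k
    module

theorem qBinomSum_map (q : ℂ) (T : M →ₗ[ℂ] M') (n : ℕ) (f : ℤ → M) :
    qBinomSum q n (fun k => T (f k)) = T (qBinomSum q n f) := by
  induction n generalizing f with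
  | zero => rfl
  | succ n ih => simp only [qBinomSum, ← map_smul, ← map_add, ih]

theorem qBinomSum_smul (q c : ℂ) (n : ℕ) (f : ℤ → M) :
    qBinomSum q n (fun k => c • f k) = c • qBinomSum q n f :=
  qBinomSum_map q (c • LinearMap.id) n f

theorem qBinomSum_mul (q c : ℂ) (n : ℕ) (f : ℤ → ℂ) :
    qBinomSum q n (fun k => c * f k) = c * qBinomSum q n f :=
  qBinomSum_smul q c n f

theorem qBinomSum_sub (q : ℂ) (n : ℕ) (f g : ℤ → M) :
    qBinomSum q n (fun k => f k - g k) = qBinomSum q n f - qBinomSum q n g := by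
  rw [eq_sub_iff_add_eq, ← qBinomSum_add]
  simp

/-- The second form of the `q`-Pascal rule. -/
theorem qBinomSum_succ {q : ℂ} (hq : q ≠ 0) (n : ℕ) (f : ℤ → M) :
    qBinomSum q (n + 1) f =
      qBinomSum q n fun k => f k + q ^ ((n : ℤ) - k) • f (k + 1) := by
  induction n generalizing f with
  | zero => simp [qBinomSum, add_comm]
  | succ n ih =>
    rw [qBinomSum, ih, qBinomSum]
    congr 1
    funext k
    simp only [smul_add, smul_smul, ← zpow_add₀ hq]
    rw [show (n : ℤ) - k + (k + 1) = n + 1 by ring,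
      show ((n + 1 : ℕ) : ℤ) - (k + 1) = n - k by push_cast; ring,
      show k + (((n + 1 : ℕ) : ℤ) - k) = n + 1 by push_cast; ring]
    abel

theorem qBinomSum_reflect {q : ℂ} (hq : q ≠ 0) (n : ℕ) (f : ℤ → M) :
    qBinomSum q n (fun k => f (n - k)) = qBinomSum q n f := by
  induction n generalizing f with
  | zero => simp [qBinomSum]
  | succ n ih =>
    rw [qBinomSum_succ hq n f, ← ih, qBinomSum]
    congr 1
    funext k
    rw [show ((n + 1 : ℕ) : ℤ) - (k + 1) = n - k by push_cast; ring,
      show ((n + 1 : ℕ) : ℤ) - k = n - k + 1 by push_cast; ring, sub_sub_cancel]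

/-- Absorption: `(1 - q^k) [n+1, k] = (1 - q^(n+1)) [n, k-1]`. -/
theorem qBinomSum_one_sub_pow_smul {q : ℂ} (hq : q ≠ 0) (n : ℕ) (f : ℤ → M) :
    qBinomSum q (n + 1) (fun k => (1 - q ^ k) • f k) =
      (1 - q ^ (n + 1)) • qBinomSum q n fun k => f (k + 1) := by
  have h : (fun k => (1 - q ^ k) • f k) = fun k => f k - q ^ k • f k := by
    funext k
    module
  rw [h, qBinomSum_sub, qBinomSum_succ hq n fun k => q ^ k • f k, qBinomSum, ← qBinomSum_sub,
    ← qBinomSum_smul]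
  congr 1
  funext k
  rw [smul_smul, ← zpow_add₀ hq, show (n : ℤ) - k + (k + 1) = (n + 1 : ℕ) by push_cast; ring,
    zpow_natCast]
  module

/-- The three-term recurrence behind the `q`-Hermite polynomials. -/
theorem qBinomSum_succ_succ {q : ℂ} (hq : q ≠ 0) (n : ℕ) (f : ℤ → M) :
    qBinomSum q (n + 2) f = qBinomSum q (n + 1) (fun k => f k + f (k + 1)) -
      (1 - q ^ (n + 1)) • qBinomSum q n fun k => f (k + 1) := by
  rw [← qBinomSum_one_sub_pow_smul hq, ← qBinomSum_sub, qBinomSum]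
  congr 1
  funext k
  module

end Functional

/-! ### The `q`-Lucas polynomials and the expansion of powers of `X` -/

section LucasOperator

theorem qDeriv_X_pow (q : ℂ) (n : ℕ) :
    qDeriv q (X ^ (n + 1)) = ((1 - q)⁻¹ * (1 - q ^ (n + 1))) • X ^ n := by
  have h : (X ^ (n + 1) - (X ^ (n + 1) : ℂ[X]).comp (C q * X)) =
      C (1 - q ^ (n + 1)) * (X ^ n * X) := by
    simp only [pow_comp, X_comp, mul_pow, C_sub, C_1, C_pow]
    ring
  change (1 - q)⁻¹ • (X ^ (n + 1) - (X ^ (n + 1) : ℂ[X]).comp (C q * X)).divX = _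
  have hd : (X ^ n * X : ℂ[X]).divX = X ^ n := by
    ext k
    rw [coeff_divX, coeff_mul_X]
  rw [h, divX_C_mul, hd, mul_smul, smul_eq_C_mul (1 - q ^ (n + 1))]

theorem lucasOp_X_pow {q : ℂ} (hq : q ≠ 1) (s : ℂ) (n : ℕ) :
    lucasOp s q (X ^ (n + 1)) = X ^ (n + 2) - (s * (1 - q ^ (n + 1))) • X ^ n := by
  have h : 1 - q ≠ 0 := sub_ne_zero.mpr hq.symm
  simp only [lucasOp, LinearMap.add_apply, LinearMap.mulLeft_apply, LinearMap.smul_apply,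
    qDeriv_X_pow, smul_smul]
  rw [show (q - 1) * s * ((1 - q)⁻¹ * (1 - q ^ (n + 1))) = -(s * (1 - q ^ (n + 1))) by
    field_simp; ring]
  rw [neg_smul, ← sub_eq_add_neg]
  ring

theorem lucasOp_one (s q : ℂ) : lucasOp s q 1 = X := by
  simp [lucasOp, qDeriv]

theorem qLucas_zero (s q : ℂ) : qLucas s q 0 = 2 := by
  rw [qLucas, lucas, map_ofNat, Module.End.ofNat_apply, ofNat_smul_eq_nsmul, nsmul_one]
  norm_num

theorem qLucas_one (s q : ℂ) : qLucas s q 1 = X := by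
  simp [qLucas, lucas, lucasOp_one]

theorem lucasOp_qLucas (s q : ℂ) (n : ℕ) :
    lucasOp s q (qLucas s q (n + 1)) = qLucas s q (n + 2) - s • qLucas s q n := by
  simp [qLucas, lucas]

/-- The `q`-Lucas polynomials with `s = -q⁻¹`, continued to negative indices. -/
def qLucasInt (q : ℂ) (m : ℤ) : ℂ[X] :=
  -- The truncated exponent is `0` for `m ≥ 0` and `|m|` for `m < 0`.
  q ^ (m.natAbs - m.toNat) • qLucas (-q⁻¹) q m.natAbs

theorem qLucasInt_natCast (q : ℂ) (n : ℕ) : qLucasInt q n = qLucas (-q⁻¹) q n := by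
  simp [qLucasInt]

theorem qLucasInt_neg_natCast (q : ℂ) (n : ℕ) :
    qLucasInt q (-n) = q ^ n • qLucas (-q⁻¹) q n := by
  simp [qLucasInt]

/-- The factor in `L_(-n) = q^n L_n` is what carries the recurrence across `0`: there `L_1 + q⁻¹
L_(-1) = 2X`, matching `L_0 = 2`. -/
theorem lucasOp_qLucasInt {q : ℂ} (hq : q ≠ 0) (m : ℤ) :
    lucasOp (-q⁻¹) q (qLucasInt q m) = qLucasInt q (m + 1) + q⁻¹ • qLucasInt q (m - 1) := by
  rcases lt_trichotomy m 0 with hm | rfl | hm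
  · obtain ⟨n, rfl⟩ : ∃ n : ℕ, m = -((n + 1 : ℕ) : ℤ) := ⟨(-m).toNat - 1, by omega⟩
    rw [show -((n + 1 : ℕ) : ℤ) + 1 = -(n : ℤ) by push_cast; ring,
      show -((n + 1 : ℕ) : ℤ) - 1 = -((n + 2 : ℕ) : ℤ) by push_cast; ring,
      qLucasInt_neg_natCast, qLucasInt_neg_natCast, qLucasInt_neg_natCast, map_smul,
      lucasOp_qLucas, smul_sub, smul_smul, smul_smul,
      show q ^ (n + 1) * -q⁻¹ = -q ^ n by field_simp; ring,
      show q⁻¹ * q ^ (n + 2) = q ^ (n + 1) by field_simp; ring]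
    module
  · have h0 := qLucasInt_natCast q 0
    have h1 := qLucasInt_natCast q 1
    have h2 := qLucasInt_neg_natCast q 1
    rw [qLucas_zero] at h0
    rw [qLucas_one] at h1 h2
    simp only [Nat.cast_zero, Nat.cast_one, pow_one] at h0 h1 h2
    rw [zero_add, zero_sub, h0, h1, h2, smul_smul, inv_mul_cancel₀ hq, one_smul,
      show (2 : ℂ[X]) = (2 : ℂ) • 1 by rw [two_smul]; norm_num, map_smul, lucasOp_one]
    module
  · obtain ⟨n, rfl⟩ : ∃ n : ℕ, m = ((n + 1 : ℕ) : ℤ) := ⟨m.toNat - 1, by omega⟩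
    rw [show ((n + 1 : ℕ) : ℤ) + 1 = ((n + 2 : ℕ) : ℤ) by push_cast; ring,
      show ((n + 1 : ℕ) : ℤ) - 1 = (n : ℤ) by push_cast; ring,
      qLucasInt_natCast, qLucasInt_natCast, qLucasInt_natCast, lucasOp_qLucas]
    module

/-- Powers of `X` expanded in the `q`-Lucas polynomials. -/
theorem qBinomSum_qLucasInt {q : ℂ} (hq : q ≠ 0) (hq1 : q ≠ 1) (n : ℕ) :
    qBinomSum q n (fun k => q ^ (-k) • qLucasInt q (n - 2 * k)) = (2 : ℂ) • X ^ n := by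
  induction n using Nat.twoStepInduction with
  | zero =>
    have h0 := qLucasInt_natCast q 0
    rw [qLucas_zero] at h0
    simp only [Nat.cast_zero] at h0
    simp only [qBinomSum, Nat.cast_zero, neg_zero, zpow_zero, mul_zero, sub_zero, h0, one_smul,
      pow_zero, two_smul]
    norm_num
  | one =>
    have h1 := qLucasInt_natCast q 1
    have h2 := qLucasInt_neg_natCast q 1
    rw [qLucas_one] at h1 h2
    simp only [Nat.cast_one, pow_one] at h1 h2
    simp only [qBinomSum, zero_add, zpow_zero, one_smul, mul_one, Nat.cast_one, neg_zero, mul_zero,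
      sub_zero, show (1 : ℤ) - 2 = -1 by norm_num, h1, h2, smul_smul, zpow_neg_one,
      inv_mul_cancel₀ hq, pow_one, two_smul]
  | more n ih0 ih1 =>
    -- Adjacent terms combine into `lucasOp` applied at level `n + 1`; the correction cancels the
    -- lower term of `lucasOp_X_pow` because `s = -q⁻¹`.
    rw [qBinomSum_succ_succ hq]
    have e0 : (fun k : ℤ => q ^ (-(k + 1)) • qLucasInt q ((n + 2 : ℕ) - 2 * (k + 1))) =
        fun k => q⁻¹ • (q ^ (-k) • qLucasInt q (n - 2 * k)) := by
      funext k
      rw [smul_smul, ← zpow_neg_one, ← zpow_add₀ hq]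
      push_cast
      congr 2 <;> ring
    have e1 : (fun k : ℤ => q ^ (-k) • qLucasInt q ((n + 2 : ℕ) - 2 * k) +
          q ^ (-(k + 1)) • qLucasInt q ((n + 2 : ℕ) - 2 * (k + 1))) =
        fun k => lucasOp (-q⁻¹) q (q ^ (-k) • qLucasInt q ((n + 1 : ℕ) - 2 * k)) := by
      funext k
      rw [map_smul, lucasOp_qLucasInt hq, smul_add, smul_smul, ← zpow_neg_one,
        ← zpow_add₀ hq]
      push_cast
      congr 3 <;> ring
    rw [e1, e0, qBinomSum_map, qBinomSum_smul, ih0, ih1, map_smul, lucasOp_X_pow hq1]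
    module

end LucasOperator

/-! ### The finite theta identity -/

section Theta

/-- The sequence `q ^ (2 * m * (m + 1) / 3)` on the multiples of three, zero elsewhere. -/
def thetaCoeff (q : ℂ) (m : ℤ) : ℂ :=
  if 3 ∣ m then q ^ (6 * (m / 3) ^ 2 + 2 * (m / 3)) else 0

theorem thetaCoeff_three_mul (q : ℂ) (j : ℤ) :
    thetaCoeff q (3 * j) = q ^ (6 * j ^ 2 + 2 * j) := by
  simp [thetaCoeff]

theorem thetaCoeff_of_not_dvd (q : ℂ) {m : ℤ} (hm : ¬ 3 ∣ m) : thetaCoeff q m = 0 :=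
  if_neg hm

theorem thetaCoeff_zero (q : ℂ) : thetaCoeff q 0 = 1 := by
  simp [thetaCoeff]

theorem thetaCoeff_neg_one (q : ℂ) : thetaCoeff q (-1) = 0 :=
  thetaCoeff_of_not_dvd q (by decide)

theorem thetaCoeff_add_three {q : ℂ} (hq : q ≠ 0) (m : ℤ) :
    thetaCoeff q (m + 3) = q ^ (4 * m + 8) * thetaCoeff q m := by
  by_cases h : 3 ∣ m
  · obtain ⟨j, rfl⟩ := h
    rw [show 3 * j + 3 = 3 * (j + 1) by ring, thetaCoeff_three_mul, thetaCoeff_three_mul,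
      ← zpow_add₀ hq]
    congr 1
    ring
  · rw [thetaCoeff_of_not_dvd q h, thetaCoeff_of_not_dvd q (by omega), mul_zero]

/-- Apply one Pascal rule to each half: both produce `q^(n+1) * thetaCoeff q (n - k)`, which
cancels. -/
theorem qBinomSum_thetaCoeff_even_eq_odd {q : ℂ} (hq : q ≠ 0) (n : ℕ) :
    qBinomSum q (2 * n + 2) (fun k => q ^ (-((n + 1 : ℤ) - k)) * thetaCoeff q (n + 1 - k) -
        q ^ ((n + 1 : ℤ) - k) * thetaCoeff q (n + 1 - k - 1)) =
      qBinomSum q (2 * n + 1) (fun k => q ^ (-((n + 1 : ℤ) - k)) * thetaCoeff q (n + 1 - k) -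
        q ^ ((n + 1 : ℤ) - k - 1) * thetaCoeff q (n + 1 - k - 2)) := by
  rw [qBinomSum_sub, qBinomSum_succ hq (2 * n + 1)]
  conv_lhs => rw [qBinomSum.eq_def q (2 * n + 2)]
  dsimp only
  rw [← qBinomSum_sub]
  congr 1
  funext k
  simp only [smul_eq_mul, ← mul_assoc, ← zpow_add₀ hq]
  push_cast
  rw [show (n : ℤ) + 1 - (k + 1) - 1 = n + 1 - k - 2 by ring,
    show (n : ℤ) + 1 - (k + 1) = n + 1 - k - 1 by ring,
    show (2 * n + 1 : ℤ) - k + -(n + 1 - k - 1) = n + 1 by ring,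
    show k + ((n : ℤ) + 1 - k) = n + 1 by ring]
  ring

/-- With the Pascal rules exchanged, the extra terms sit three indices apart; quasi-periodicity
`thetaCoeff_add_three` makes them cancel. -/
theorem qBinomSum_thetaCoeff_odd_eq_even {q : ℂ} (hq : q ≠ 0) (n : ℕ) :
    qBinomSum q (2 * n + 1) (fun k => q ^ (-((n + 1 : ℤ) - k)) * thetaCoeff q (n + 1 - k) -
        q ^ ((n + 1 : ℤ) - k - 1) * thetaCoeff q (n + 1 - k - 2)) =
      qBinomSum q (2 * n) (fun k => q ^ (-((n : ℤ) - k)) * thetaCoeff q (n - k) -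
        q ^ ((n : ℤ) - k) * thetaCoeff q (n - k - 1)) := by
  rw [qBinomSum_sub, qBinomSum_succ hq (2 * n) (fun k => q ^ ((n + 1 : ℤ) - k - 1) * _),
    qBinomSum, ← qBinomSum_sub]
  congr 1
  funext k
  have h := thetaCoeff_add_three hq ((n : ℤ) - k - 2)
  rw [show (n : ℤ) - k - 2 + 3 = n + 1 - k by ring] at h
  simp only [smul_eq_mul, ← mul_assoc, ← zpow_add₀ hq]
  push_cast
  rw [h, show (n : ℤ) + 1 - (k + 1) - 2 = n - k - 2 by ring,
    show (n : ℤ) + 1 - (k + 1) = n - k by ring, show (n : ℤ) + 1 - k - 2 = n - k - 1 by ring,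
    ← mul_assoc, ← zpow_add₀ hq,
    show k + -((n : ℤ) + 1 - k) + (4 * (n - k - 2) + 8) = 2 * n - k + (n - k - 1) by ring,
    show (n : ℤ) + 1 - k - 1 = n - k by ring]
  ring

theorem qBinomSum_thetaCoeff_even {q : ℂ} (hq : q ≠ 0) (n : ℕ) :
    qBinomSum q (2 * n) (fun k => q ^ (-((n : ℤ) - k)) * thetaCoeff q (n - k) -
      q ^ ((n : ℤ) - k) * thetaCoeff q (n - k - 1)) = 1 := by
  induction n with
  | zero => simp [qBinomSum, thetaCoeff_zero, thetaCoeff_neg_one]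
  | succ n ih =>
    rw [← qBinomSum_thetaCoeff_odd_eq_even hq, ← qBinomSum_thetaCoeff_even_eq_odd hq] at ih
    push_cast
    exact ih

/-- The coefficients of the theta series, indexed by their `q`-Lucas index. -/
def thetaDiff (q : ℂ) (m : ℤ) : ℂ :=
  thetaCoeff q m - thetaCoeff q (m - 1)

/-- A finite form of the theta series identity. -/
theorem qBinomSum_thetaDiff {q : ℂ} (hq : q ≠ 0) (n : ℕ) :
    qBinomSum q (2 * n) (fun k => thetaDiff q (n - k)) = q ^ n := by
  simp only [thetaDiff]
  cases n with
  | zero => simp [qBinomSum, thetaCoeff_zero, thetaCoeff_neg_one]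
  | succ n =>
    have h := qBinomSum_thetaCoeff_even hq n
    rw [← qBinomSum_thetaCoeff_odd_eq_even hq] at h
    -- Opposite Pascal rules on the two halves leave `q^(n+1)` times the odd sum, already known to
    -- be `1`.
    rw [show 2 * (n + 1) = 2 * n + 1 + 1 by ring, qBinomSum_sub,
      qBinomSum_succ hq (2 * n + 1) (fun k => thetaCoeff q (_ - k - 1)), qBinomSum,
      ← qBinomSum_sub, ← mul_one (q ^ (n + 1)), ← h, ← qBinomSum_mul]
    congr 1
    funext k
    rw [← zpow_natCast]
    simp only [smul_eq_mul, mul_sub, ← mul_assoc, ← zpow_add₀ hq]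
    push_cast
    rw [show (n : ℤ) + 1 - (k + 1) - 1 = n + 1 - k - 2 by ring,
      show (n : ℤ) + 1 - (k + 1) = n + 1 - k - 1 by ring,
      show (n : ℤ) + 1 + -(n + 1 - k) = k by ring,
      show (n : ℤ) + 1 + (n + 1 - k - 1) = 2 * n + 1 - k by ring]
    ring

end Theta

/-! ### Gaussian binomials as quotients, and triangular inversion -/

section InversePochhammer

/-- `1 / (q; q)_k`, extended by zero to negative `k`. -/
def invPoch (q : ℂ) (k : ℤ) : ℂ :=
  if 0 ≤ k then (qPoch q q k.toNat)⁻¹ else 0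

theorem invPoch_natCast (q : ℂ) (n : ℕ) : invPoch q n = (qPoch q q n)⁻¹ := by
  simp [invPoch]

theorem invPoch_of_neg (q : ℂ) {k : ℤ} (hk : k < 0) : invPoch q k = 0 :=
  if_neg (by omega)

theorem invPoch_zero (q : ℂ) : invPoch q 0 = 1 := by
  simp [invPoch, qPoch]

variable {q : ℂ}

theorem one_sub_pow_ne_zero (hq1 : ‖q‖ < 1) (n : ℕ) : 1 - q ^ (n + 1) ≠ 0 := by
  intro h
  have h2 : ‖q ^ (n + 1)‖ = 1 := by rw [← sub_eq_zero.mp h, norm_one]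
  rw [norm_pow] at h2
  exact (pow_lt_one₀ (norm_nonneg q) hq1 n.succ_ne_zero).ne h2

theorem qPoch_ne_zero (hq1 : ‖q‖ < 1) (n : ℕ) : qPoch q q n ≠ 0 :=
  Finset.prod_ne_zero_iff.mpr fun j _ => by
    rw [← pow_succ]
    exact one_sub_pow_ne_zero hq1 j

/-- Extension by zero is consistent at `k = -1`, where `1 - q^0` vanishes. -/
theorem invPoch_eq (hq1 : ‖q‖ < 1) (k : ℤ) :
    invPoch q k = (1 - q ^ (k + 1)) * invPoch q (k + 1) := by
  rcases lt_trichotomy k (-1) with hk | rfl | hk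
  · rw [invPoch_of_neg q (by omega), invPoch_of_neg q (by omega), mul_zero]
  · simp [invPoch]
  · lift k to ℕ using by omega
    have h := one_sub_pow_ne_zero hq1 k
    rw [← Nat.cast_succ, invPoch_natCast, invPoch_natCast, zpow_natCast, qPoch, qPoch,
      Finset.prod_range_succ, ← pow_succ, mul_inv, mul_comm, mul_assoc, inv_mul_cancel₀ h, mul_one]

/-- The Pascal rule for the quotients is `1 - q^(n+1) = (1 - q^k) + q^k (1 - q^(n+1-k))`. -/
theorem hasSum_qBinomSum (hq0 : q ≠ 0) (hq1 : ‖q‖ < 1) (n : ℕ) (f : ℤ → ℂ) :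
    HasSum (fun k : ℤ => invPoch q k * invPoch q (n - k) * f k)
      (invPoch q n * qBinomSum q n f) := by
  induction n generalizing f with
  | zero =>
    have h := hasSum_single (f := fun k : ℤ => invPoch q k * invPoch q ((0 : ℕ) - k) * f k) 0 ?_
    · simpa [qBinomSum, invPoch_zero] using h
    · intro k hk
      rcases lt_or_gt_of_ne hk with hk | hk
      · simp [invPoch_of_neg q hk]
      · rw [invPoch_of_neg q (show ((0 : ℕ) : ℤ) - k < 0 by simpa using hk), mul_zero, zero_mul]
  | succ n ih =>
    have h1 := (Equiv.subRight (1 : ℤ)).hasSum_iff.mpr (ih fun k => f (k + 1))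
    have h2 := ih fun k => q ^ k • f k
    have h := h1.add h2
    rw [← mul_add, ← qBinomSum_add, invPoch_eq hq1 n, mul_assoc] at h
    rw [← hasSum_mul_left_iff (one_sub_pow_ne_zero hq1 n)]
    have hterm : (fun k : ℤ => (1 - q ^ (n + 1)) *
        (invPoch q k * invPoch q ((n + 1 : ℕ) - k) * f k)) = fun k =>
        ((fun k => invPoch q k * invPoch q (n - k) * f (k + 1)) ∘ ⇑(Equiv.subRight (1 : ℤ))) k +
          invPoch q k * invPoch q (n - k) * q ^ k • f k := by
      funext k
      have e1 := invPoch_eq hq1 (k - 1)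
      have e2 := invPoch_eq hq1 (n - k)
      have e3 : q ^ (n + 1) = q ^ k * q ^ ((n : ℤ) - k + 1) := by
        rw [← zpow_add₀ hq0, ← zpow_natCast]
        congr 1
        push_cast
        ring
      simp only [Function.comp_apply, Equiv.subRight_apply, sub_add_cancel, smul_eq_mul] at e1 ⊢
      rw [e1, e2, e3, show (n : ℤ) - (k - 1) = n - k + 1 by ring,
        show ((n + 1 : ℕ) : ℤ) - k = n - k + 1 by push_cast; ring]
      ring
    rw [hterm]
    exact_mod_cast h

/-- A symmetric sequence is determined by its sums against the central Gaussian binomial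
coefficients. -/
theorem eq_zero_of_qBinomSum_eq_zero (hq0 : q ≠ 0) (hq1 : ‖q‖ < 1) (d : ℤ → ℂ)
    (hd : ∀ m, d (-m) = d m)
    (h : ∀ n : ℕ, qBinomSum q (2 * n) (fun k => d (n - k)) = 0) (n : ℕ) : d n = 0 := by
  induction n using Nat.strong_induction_on with
  | _ n ih =>
    have hn := hasSum_qBinomSum hq0 hq1 (2 * n) fun k => d (n - k)
    rw [h, mul_zero] at hn
    -- By induction and symmetry only `k = 0` and `k = 2n` survive, with equal nonzero coefficients.
    have hn' := hasSum_sum_of_ne_finset_zero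
      (f := fun k : ℤ => invPoch q k * invPoch q ((2 * n : ℕ) - k) * d (n - k))
      (s := {0, 2 * (n : ℤ)}) (L := .unconditional ℤ) ?_
    · have e := hn'.unique hn
      have hp : invPoch q (2 * n : ℕ) ≠ 0 := by
        rw [invPoch_natCast]
        exact inv_ne_zero (qPoch_ne_zero hq1 _)
      rcases eq_or_ne n 0 with rfl | hn0
      · simpa [invPoch_zero] using e
      · rw [Finset.sum_pair (by omega), sub_zero, sub_zero] at e
        push_cast at e hp
        rw [sub_self, show (n : ℤ) - 2 * n = -n by ring, hd, invPoch_zero, one_mul, mul_one,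
          ← two_mul] at e
        simpa [hp] using e
    · intro k hk
      simp only [Finset.mem_insert, Finset.mem_singleton, not_or] at hk
      rcases lt_or_ge k 0 with h0 | h0
      · simp [invPoch_of_neg q h0]
      rcases lt_or_ge (2 * (n : ℤ)) k with h1 | h1
      · rw [invPoch_of_neg q (show ((2 * n : ℕ) : ℤ) - k < 0 by push_cast; omega), mul_zero,
          zero_mul]
      have : d (n - k) = d ((n - k : ℤ).natAbs : ℕ) := by
        rcases Int.natAbs_eq ((n : ℤ) - k) with e | e
        · rw [← e]
        · rw [← hd, congrArg Neg.neg e,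
            neg_neg]
      rw [this, ih _ (by omega), mul_zero]

end InversePochhammer

/-- The even `q`-Lucas values at `x = 1`, `s = -q⁻¹`. -/
theorem eval_qLucas_two_mul {q : ℂ} (hq0 : q ≠ 0) (hq1 : ‖q‖ < 1) (n : ℕ) :
    q ^ n * (qLucas (-q⁻¹) q (2 * n)).eval 1 =
      thetaDiff q n + thetaDiff q (-n) := by
  have hne : q ≠ 1 := by
    rintro rfl
    simp at hq1
  have hsymm : ∀ m : ℤ, (q ^ (-m) * (qLucasInt q (2 * -m)).eval 1) =
      q ^ m * (qLucasInt q (2 * m)).eval 1 := by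
    have key : ∀ k : ℕ, (q ^ (-(k : ℤ)) * (qLucasInt q (2 * -(k : ℤ))).eval 1) =
        q ^ (k : ℤ) * (qLucasInt q (2 * k)).eval 1 := by
      intro k
      rw [show (2 * -(k : ℤ)) = -((2 * k : ℕ) : ℤ) by push_cast; ring,
        show (2 * (k : ℤ)) = ((2 * k : ℕ) : ℤ) by push_cast; ring,
        qLucasInt_natCast, qLucasInt_neg_natCast, eval_smul, smul_eq_mul, ← mul_assoc,
        ← zpow_natCast q (2 * k), ← zpow_add₀ hq0]
      congr 2
      push_cast
      ring
    intro m
    rcases Int.eq_nat_or_neg m with ⟨k, rfl | rfl⟩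
    · exact key k
    · rw [neg_neg]
      exact (key k).symm
  have hsum : ∀ n : ℕ, qBinomSum q (2 * n)
      (fun k => q ^ ((n : ℤ) - k) * (qLucasInt q (2 * (n - k))).eval 1) = 2 * q ^ n := by
    intro n
    have h := congrArg (Polynomial.leval (1 : ℂ)) (qBinomSum_qLucasInt hq0 hne (2 * n))
    rw [← qBinomSum_map] at h
    simp only [leval_apply, eval_smul, eval_pow, eval_X, one_pow, smul_eq_mul, mul_one] at h
    rw [mul_comm (2 : ℂ), ← h, ← qBinomSum_mul]
    congr 1
    funext k
    rw [← mul_assoc, ← zpow_natCast, ← zpow_add₀ hq0]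
    push_cast
    rw [mul_sub, sub_eq_add_neg]
  have htheta : ∀ n : ℕ, qBinomSum q (2 * n)
      (fun k => thetaDiff q (n - k) + thetaDiff q (-(n - k))) = 2 * q ^ n := by
    intro n
    have h := qBinomSum_reflect hq0 (2 * n) fun k => thetaDiff q (n - k)
    have e : (fun k : ℤ => thetaDiff q (n - ((2 * n : ℕ) - k))) =
        fun k => thetaDiff q (-(n - k)) := by
      funext k
      congr 1
      push_cast
      ring
    rw [qBinomSum_add, ← e, h, qBinomSum_thetaDiff hq0, two_mul]
  have h := eq_zero_of_qBinomSum_eq_zero hq0 hq1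
    (fun m => q ^ m * (qLucasInt q (2 * m)).eval 1 - (thetaDiff q m + thetaDiff q (-m)))
    (fun m => by rw [hsymm, neg_neg, add_comm (thetaDiff q (-m))])
    (fun n => by rw [qBinomSum_sub, hsum, htheta, sub_self]) n
  rw [sub_eq_zero, zpow_natCast, show 2 * (n : ℤ) = (2 * n : ℕ) by push_cast; ring,
    qLucasInt_natCast] at h
  exact h

/-! ### Convergence, Cauchy's identity and the interchange of sums -/

section Analytic

open Filter Topology

variable {q : ℂ}

theorem multipliable_one_sub_pow (hq1 : ‖q‖ < 1) : Multipliable fun j : ℕ => 1 - q ^ j * q := by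
  simp only [sub_eq_add_neg]
  apply multipliable_one_add_of_summable
  simpa using (summable_geometric_of_lt_one (norm_nonneg q) hq1).mul_right ‖q‖

theorem qPochInf_ne_zero (hq1 : ‖q‖ < 1) : qPochInf q q ≠ 0 := by
  simp only [qPochInf, sub_eq_add_neg]
  refine tprod_one_add_ne_zero_of_summable (fun j => ?_) ?_
  · rw [← sub_eq_add_neg, ← pow_succ]
    exact one_sub_pow_ne_zero hq1 j
  · simpa using (summable_geometric_of_lt_one (norm_nonneg q) hq1).mul_right ‖q‖

theorem tendsto_invPoch (hq1 : ‖q‖ < 1) :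
    Tendsto (fun n : ℕ => invPoch q n) atTop (𝓝 (qPochInf q q)⁻¹) := by
  simp only [invPoch_natCast]
  exact (multipliable_one_sub_pow hq1).tendsto_prod_tprod_nat.inv₀ (qPochInf_ne_zero hq1)

theorem tendsto_invPoch_add (hq1 : ‖q‖ < 1) (k : ℤ) :
    Tendsto (fun n : ℕ => invPoch q (n + k)) atTop (𝓝 (qPochInf q q)⁻¹) := by
  have h : Tendsto (fun n : ℕ => ((n : ℤ) + k).toNat) atTop atTop :=
    tendsto_atTop.mpr fun b => (eventually_ge_atTop (b + k.natAbs)).mono fun n hn => by omega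
  refine ((tendsto_invPoch hq1).comp h).congr' ?_
  filter_upwards [eventually_ge_atTop k.natAbs] with n hn
  rw [Function.comp_apply, Int.toNat_of_nonneg (by omega)]

theorem exists_norm_invPoch_le (hq1 : ‖q‖ < 1) : ∃ K : ℝ, ∀ k : ℤ, ‖invPoch q k‖ ≤ K := by
  obtain ⟨K, hK⟩ := (Metric.isBounded_range_of_tendsto _ (tendsto_invPoch hq1)).exists_norm_le
  refine ⟨K, fun k => ?_⟩
  rcases lt_or_ge k 0 with h | h
  · rw [invPoch_of_neg q h, norm_zero]
    exact (norm_nonneg _).trans (hK _ ⟨0, rfl⟩)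
  · lift k to ℕ using h
    exact hK _ ⟨k, rfl⟩

theorem summable_zpow_sq {r : ℝ} (h0 : 0 ≤ r) (h1 : r < 1) :
    Summable fun n : ℤ => r ^ (n ^ 2) := by
  have h : Summable fun n : ℕ => r ^ ((n : ℤ) ^ 2) := by
    refine (summable_geometric_of_lt_one h0 h1).of_nonneg_of_le (fun n => by positivity)
      fun n => ?_
    rw [← Nat.cast_pow, zpow_natCast]
    exact pow_le_pow_of_le_one h0 h1.le (Nat.le_self_pow two_ne_zero n)
  exact .of_nat_of_neg h (by simpa using h)

/-- A finite form of Cauchy's identity. -/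
theorem qBinomSum_zpow_sq_mul_invPoch (hq0 : q ≠ 0) (hq1 : ‖q‖ < 1) (n : ℕ) (a : ℤ) :
    qBinomSum q n (fun k => q ^ (k ^ 2 + a * k) * invPoch q (k + a)) = invPoch q (n + a) := by
  induction n generalizing a with
  | zero => simp [qBinomSum]
  | succ n ih =>
    have e : (fun k : ℤ => q ^ (k ^ 2 + a * k) * invPoch q (k + a) +
          q ^ ((n : ℤ) - k) • (q ^ ((k + 1) ^ 2 + a * (k + 1)) * invPoch q (k + 1 + a))) =
        fun k => q ^ (k ^ 2 + a * k) * invPoch q (k + a) +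
          q ^ ((n : ℤ) + 1 + a) * (q ^ (k ^ 2 + (a + 1) * k) * invPoch q (k + (a + 1))) := by
      funext k
      rw [smul_eq_mul, ← mul_assoc, ← mul_assoc, ← zpow_add₀ hq0, ← zpow_add₀ hq0,
        show k + 1 + a = k + (a + 1) by ring,
        show (n : ℤ) - k + ((k + 1) ^ 2 + a * (k + 1)) =
          n + 1 + a + (k ^ 2 + (a + 1) * k) by ring]
    rw [qBinomSum_succ hq0, e, qBinomSum_add, qBinomSum_mul, ih, ih, invPoch_eq hq1 (n + a),
      show (n : ℤ) + a + 1 = n + 1 + a by ring, show (n : ℤ) + (a + 1) = n + 1 + a by ring,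
      Nat.cast_succ]
    ring

/-- Cauchy's identity `∑ q^(n^2) / ((q; q)_(n-m) (q; q)_(n+m)) = q^(m^2) / (q; q)_∞`. -/
theorem hasSum_zpow_sq_mul_invPoch (hq0 : q ≠ 0) (hq1 : ‖q‖ < 1) (m : ℤ) :
    HasSum (fun n : ℤ => q ^ (n ^ 2) * (invPoch q (n - m) * invPoch q (n + m)))
      (q ^ (m ^ 2) * (qPochInf q q)⁻¹) := by
  obtain ⟨K, hK⟩ := exists_norm_invPoch_le hq1
  have hK0 : 0 ≤ K := (norm_nonneg _).trans (hK 0)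
  have hsq := summable_zpow_sq (norm_nonneg q) hq1
  have hsum : Summable
      fun n : ℤ => q ^ (n ^ 2) * (invPoch q (n - m) * invPoch q (n + m)) := by
    refine .of_norm_bounded (hsq.mul_right (K * K)) fun n => ?_
    rw [norm_mul, norm_mul, norm_zpow]
    gcongr <;> exact hK _
  have hfin : ∀ N : ℕ, HasSum
      (fun n : ℤ => q ^ (n ^ 2) * (invPoch q (n - m) * invPoch q (n + m)) *
        invPoch q (N + (m - n)))
      (q ^ (m ^ 2) * (invPoch q N * invPoch q (N + 2 * m))) := by
    intro N
    have h := hasSum_qBinomSum hq0 hq1 N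
      fun k => q ^ (k ^ 2 + 2 * m * k) * invPoch q (k + 2 * m)
    rw [qBinomSum_zpow_sq_mul_invPoch hq0 hq1] at h
    refine ((Equiv.subRight m).hasSum_iff.mpr (h.mul_left (q ^ (m ^ 2)))).congr_fun fun n => ?_
    rw [Function.comp_apply, Equiv.subRight_apply,
      show n ^ 2 = m ^ 2 + ((n - m) ^ 2 + 2 * m * (n - m)) by ring, zpow_add₀ hq0,
      show n - m + 2 * m = n + m by ring, show (N : ℤ) - (n - m) = N + (m - n) by ring]
    ring
  -- The extra factor `invPoch q (N + (m - n))` tends to `(q;q)_∞⁻¹`, which then cancels from both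
  -- sides.
  have hlim := tendsto_tsum_of_dominated_convergence
    (f := fun (N : ℕ) (n : ℤ) => q ^ (n ^ 2) * (invPoch q (n - m) * invPoch q (n + m)) *
        invPoch q (N + (m - n))) (hsq.mul_right (K * K * K))
    (fun n => (tendsto_invPoch_add hq1 (m - n)).const_mul
      (q ^ (n ^ 2) * (invPoch q (n - m) * invPoch q (n + m))))
    (Eventually.of_forall fun N n => by
      rw [norm_mul, norm_mul, norm_mul, norm_zpow, mul_assoc]
      gcongr <;> exact hK _)
  simp only [(hfin _).tsum_eq] at hlim
  have e := tendsto_nhds_unique hlim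
    (((tendsto_invPoch hq1).mul (tendsto_invPoch_add hq1 (2 * m))).const_mul (q ^ (m ^ 2)))
  rw [tsum_mul_right, ← mul_assoc] at e
  have e' := mul_right_cancel₀ (inv_ne_zero (qPochInf_ne_zero hq1)) e
  rw [← e']
  exact hsum.hasSum

theorem three_mul_injective : Function.Injective fun j : ℤ => 3 * j :=
  mul_right_injective₀ three_ne_zero

theorem summable_norm_thetaCoeff (hq0 : q ≠ 0) (hq1 : ‖q‖ < 1) :
    Summable fun m => ‖thetaCoeff q m‖ := by
  rw [← three_mul_injective.summable_iff]
  · refine (summable_zpow_sq (norm_nonneg q) hq1).of_nonneg_of_le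
      (fun j => norm_nonneg _) fun j => ?_
    rw [Function.comp_apply, thetaCoeff_three_mul, norm_zpow]
    exact zpow_le_zpow_right_of_le_one₀ (norm_pos_iff.mpr hq0) hq1.le
      (by nlinarith [sq_nonneg j, Int.le_self_sq (-j)])
  · intro m hm
    rw [thetaCoeff_of_not_dvd, norm_zero]
    rintro ⟨j, rfl⟩
    exact hm ⟨j, rfl⟩

theorem summable_norm_thetaDiff (hq0 : q ≠ 0) (hq1 : ‖q‖ < 1) :
    Summable fun m => ‖thetaDiff q m‖ := by
  have h := summable_norm_thetaCoeff hq0 hq1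
  refine (h.add ((Equiv.subRight (1 : ℤ)).summable_iff.mpr h)).of_nonneg_of_le
    (fun m => norm_nonneg _) fun m => ?_
  exact norm_sub_le _ _

theorem summable_thetaDiff_mul (hq0 : q ≠ 0) (hq1 : ‖q‖ < 1) :
    Summable fun m : ℤ => thetaDiff q m * q ^ (m ^ 2) := by
  refine .of_norm_bounded (summable_norm_thetaDiff hq0 hq1) fun m => ?_
  rw [norm_mul, norm_zpow]
  refine mul_le_of_le_one_right (norm_nonneg _) ?_
  exact zpow_le_one₀ (norm_pos_iff.mpr hq0) hq1.le (sq_nonneg m)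

theorem hasSum_thetaCoeff_mul {g : ℤ → ℂ} {S : ℂ} :
    HasSum (fun m => thetaCoeff q m * g m) S ↔
      HasSum (fun j : ℤ => q ^ (6 * j ^ 2 + 2 * j) * g (3 * j)) S := by
  rw [← three_mul_injective.hasSum_iff]
  · simp only [Function.comp_def, thetaCoeff_three_mul]
  · intro m hm
    rw [thetaCoeff_of_not_dvd, zero_mul]
    rintro ⟨j, rfl⟩
    exact hm ⟨j, rfl⟩

theorem hasSum_theta (hq0 : q ≠ 0) (hq1 : ‖q‖ < 1) :
    HasSum (fun k : ℤ => q ^ (15 * k ^ 2 + 2 * k) - q ^ (15 * k ^ 2 + 8 * k + 1))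
      (∑' m : ℤ, thetaDiff q m * q ^ (m ^ 2)) := by
  have hbound : ∀ e : ℤ → ℤ, Summable fun m => thetaCoeff q m * q ^ (e m ^ 2) := fun e => by
    refine .of_norm_bounded (summable_norm_thetaCoeff hq0 hq1) fun m => ?_
    rw [norm_mul, norm_zpow]
    exact mul_le_of_le_one_right (norm_nonneg _)
      (zpow_le_one₀ (norm_pos_iff.mpr hq0) hq1.le (sq_nonneg _))
  obtain ⟨S, hS⟩ := hbound id
  obtain ⟨T, hT⟩ := hbound (· + 1)
  have h : HasSum (fun m : ℤ => thetaDiff q m * q ^ (m ^ 2)) (S - T) := by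
    refine (hS.sub ((Equiv.subRight (1 : ℤ)).hasSum_iff.mpr hT)).congr_fun fun m => ?_
    simp [thetaDiff, sub_mul]
  rw [h.tsum_eq]
  refine ((hasSum_thetaCoeff_mul.mp hS).sub (hasSum_thetaCoeff_mul.mp hT)).congr_fun fun k => ?_
  rw [← zpow_add₀ hq0, ← zpow_add₀ hq0]
  rw [id, show 6 * k ^ 2 + 2 * k + (3 * k) ^ 2 = 15 * k ^ 2 + 2 * k by ring,
    show 6 * k ^ 2 + 2 * k + (3 * k + 1) ^ 2 = 15 * k ^ 2 + 8 * k + 1 by ring]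

theorem hasSum_qLucasStar (hq0 : q ≠ 0) (hq1 : ‖q‖ < 1) :
    HasSum (fun k : ℕ => qLucasStar 1 (-q⁻¹) q (2 * k) * q ^ (k ^ 2 + k))
      (∑' m : ℤ, thetaDiff q m * q ^ (m ^ 2)) := by
  have h0 : thetaDiff q 0 = 1 := by
    simp [thetaDiff, thetaCoeff_zero, thetaCoeff_neg_one]
  -- Folding `m` with `-m` counts `m = 0` twice; removing one copy is why `L*_0 = 1` rather than
  -- `2`.
  have h1 := ((summable_thetaDiff_mul hq0 hq1).hasSum.nat_add_neg).sub (hasSum_ite_eq (0 : ℕ) 1)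
  rw [h0, one_mul, show (0 : ℤ) ^ 2 = 0 by norm_num, zpow_zero, add_sub_cancel_right] at h1
  refine h1.congr_fun fun k => ?_
  rcases eq_or_ne k 0 with rfl | hk
  · simp [qLucasStar, h0]
  · rw [qLucasStar, if_neg (by omega), if_neg hk, neg_sq, ← add_mul,
      ← eval_qLucas_two_mul hq0 hq1, ← Nat.cast_pow, zpow_natCast]
    ring

/-- The Bailey pair: `qBinomSum_thetaDiff` divided by `(q;q)_(2n)` and recentred by `k = n - m`. -/
theorem hasSum_thetaDiff_mul_invPoch (hq0 : q ≠ 0) (hq1 : ‖q‖ < 1) (n : ℕ) :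
    HasSum (fun m : ℤ => invPoch q (n - m) * invPoch q (n + m) * thetaDiff q m)
      (q ^ n / qPoch q q (2 * n)) := by
  have h := hasSum_qBinomSum hq0 hq1 (2 * n) fun k => thetaDiff q (n - k)
  rw [qBinomSum_thetaDiff hq0, invPoch_natCast, inv_mul_eq_div] at h
  refine ((Equiv.subLeft (n : ℤ)).hasSum_iff.mpr h).congr_fun fun m => ?_
  simp only [Function.comp_apply, Equiv.subLeft_apply, sub_sub_cancel]
  congr 3
  push_cast
  ring

theorem hasSum_div_qPoch (hq0 : q ≠ 0) (hq1 : ‖q‖ < 1) :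
    HasSum (fun n : ℕ => q ^ (n ^ 2 + n) / qPoch q q (2 * n))
      ((∑' m : ℤ, thetaDiff q m * q ^ (m ^ 2)) * (qPochInf q q)⁻¹) := by
  obtain ⟨K, hK⟩ := exists_norm_invPoch_le hq1
  have hK0 : 0 ≤ K := (norm_nonneg _).trans (hK 0)
  have hsq : Summable fun n : ℕ => ‖q‖ ^ ((n : ℤ) ^ 2) :=
    (summable_zpow_sq (norm_nonneg q) hq1).comp_injective Nat.cast_injective
  have hF : Summable fun x : ℕ × ℤ => q ^ ((x.1 : ℤ) ^ 2) *
      (invPoch q (x.1 - x.2) * invPoch q (x.1 + x.2) * thetaDiff q x.2) := by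
    refine .of_norm_bounded ((hsq.mul_of_nonneg (summable_norm_thetaDiff hq0 hq1)
      (fun n => by positivity) fun m => norm_nonneg _).mul_left (K * K)) fun x => ?_
    rw [norm_mul, norm_mul, norm_mul, norm_zpow]
    calc ‖q‖ ^ ((x.1 : ℤ) ^ 2) *
          (‖invPoch q (x.1 - x.2)‖ * ‖invPoch q (x.1 + x.2)‖ * ‖thetaDiff q x.2‖)
        ≤ ‖q‖ ^ ((x.1 : ℤ) ^ 2) * (K * K * ‖thetaDiff q x.2‖) := by gcongr <;> exact hK _
      _ = K * K * (‖q‖ ^ ((x.1 : ℤ) ^ 2) * ‖thetaDiff q x.2‖) := by ring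
  have hrow := hF.hasSum.prod_fiberwise
    fun n => (hasSum_thetaDiff_mul_invPoch hq0 hq1 n).mul_left (q ^ ((n : ℤ) ^ 2))
  have hcol := ((Equiv.prodComm ℤ ℕ).hasSum_iff.mpr hF.hasSum).prod_fiberwise
    (g := fun m => thetaDiff q m * (q ^ (m ^ 2) * (qPochInf q q)⁻¹)) fun m => by
      have h := (hasSum_zpow_sq_mul_invPoch hq0 hq1 m).mul_left (thetaDiff q m)
      -- Cauchy's sum over `ℤ` lives on `n ≥ 0`: for `n < 0` one of `n - m`, `n + m` is negative.
      rw [← (Nat.cast_injective (R := ℤ)).hasSum_iff] at h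
      · refine h.congr_fun fun n => ?_
        simp only [Function.comp_apply, Equiv.prodComm_apply, Prod.swap_prod_mk]
        ring
      · intro n hn
        have hn0 : n < 0 := by
          by_contra hn0
          exact hn ⟨n.toNat, by simpa using hn0⟩
        rcases le_total 0 m with hm | hm
        · rw [invPoch_of_neg q (show n - m < 0 by omega)]
          ring
        · rw [invPoch_of_neg q (show n + m < 0 by omega)]
          ring
  rw [← tsum_mul_right]
  simp only [mul_assoc]
  rw [hcol.tsum_eq]
  refine hrow.congr_fun fun n => ?_
  rw [← Nat.cast_pow, zpow_natCast, pow_add, mul_div_assoc]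

end Analytic

end QLucas

end

theorem corollary5p3 (q : ℂ) (hq0 : q ≠ 0) (hq1 : ‖q‖ < 1) :
    (Multipliable (fun j : ℕ => 1 - q ^ j * q) ∧ QLucas.qPochInf q q ≠ 0) ∧
    Summable (fun n : ℕ => q ^ (n ^ 2 + n) / QLucas.qPoch q q (2 * n)) ∧
    Summable (fun k : ℕ => QLucas.qLucasStar 1 (-q⁻¹) q (2 * k) * q ^ (k ^ 2 + k)) ∧
    Summable (fun k : ℤ => q ^ (15 * k ^ 2 + 2 * k) - q ^ (15 * k ^ 2 + 8 * k + 1)) ∧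
    (∑' n : ℕ, q ^ (n ^ 2 + n) / QLucas.qPoch q q (2 * n) =
      1 / QLucas.qPochInf q q *
        ∑' k : ℕ, QLucas.qLucasStar 1 (-q⁻¹) q (2 * k) * q ^ (k ^ 2 + k)) ∧
    (1 / QLucas.qPochInf q q *
        ∑' k : ℕ, QLucas.qLucasStar 1 (-q⁻¹) q (2 * k) * q ^ (k ^ 2 + k) =
      1 / QLucas.qPochInf q q *
        ∑' k : ℤ, (q ^ (15 * k ^ 2 + 2 * k) - q ^ (15 * k ^ 2 + 8 * k + 1))) := by
  have h1 := QLucas.hasSum_div_qPoch hq0 hq1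
  have h2 := QLucas.hasSum_qLucasStar hq0 hq1
  have h3 := QLucas.hasSum_theta hq0 hq1
  refine ⟨⟨QLucas.multipliable_one_sub_pow hq1, QLucas.qPochInf_ne_zero hq1⟩, h1.summable,
    h2.summable, h3.summable, ?_, ?_⟩
  · rw [h1.tsum_eq, h2.tsum_eq, one_div, mul_comm]
  · rw [h2.tsum_eq, h3.tsum_eq]
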